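/- Let $d\ge 2$ and let $T$ be the $d$-regular rooted tree: its vertices are the finite words over an alphabet with $d$ letters, two words are adjacent if one is obtained from the other by appending a letter at the end, the root is the empty word, and the $k$-th level $V_k$ is the set of words of length $k$. For $G\le\mathrm{Aut}(T)$ and a vertex $v$ let $\mathrm{rist}_G(v)$ be the set of $g\in G$ that fix every vertex outside the subtree of words beginning with $v$, and let $\mathrm{rist}_G(k)$ be the subgroup generated by all $\mathrm{rist}_G(v)$, $v\in V_k$. The group $G$ is called branch if it acts transitively on each level $V_k$ and $\mathrm{rist}_G(k)$ has finite index in $G$ for every $k$. Let $X=\partial T$ be the boundary of $T$, identified with the space of infinite sequences of letters, and let $\mu$ be the uniform Bernoulli measure on $X$. For $n\ge 1$ let $X^n_{\mathrm{Sym}}=X^n/\mathrm{Sym}(n)$, with the quotient $\sigma$-algebra, the image $\mu^n_{\mathrm{Sym}}$ of the product measure $\mu^n$, and the action $\mathrm{diag}_n$ of $G$ induced by $g(x_1,\dots,x_n)=(gx_1,\dots,gx_n)$. **Theorem.** Let $G\le\mathrm{Aut}(T)$ be a countable branch group and let $n\ge 1$. Then the action $\mathrm{diag}_n$ of $G$ on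 $(X^n_{\mathrm{Sym}},\mu^n_{\mathrm{Sym}})$ splits into countably many ergodic components: there is an at most countable partition of $X^n_{\mathrm{Sym}}$ into measurable $G$-invariant sets $E$ of positive measure such that, for each of them, the action of $G$ is ergodic with respect to the normalized restriction of $\mu^n_{\mathrm{Sym}}$ to $E$. If $n\ge 2$, this partition is infinite. -/

import Mathlib

open MeasureTheory ProbabilityTheory

noncomputable section

/-- The `d`-regular rooted tree: the vertices are the finite words over `{0, …, d - 1}`, and two
words are joined by an edge when one of them is the other with one letter appended at the end.
The root is the empty word, and the `k`-th level is the set of words of length `k`. -/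
def rootedTree (d : ℕ) : SimpleGraph (List (Fin d)) where
  Adj v w := (∃ a, w = v ++ [a]) ∨ (∃ a, v = w ++ [a])
  symm := ⟨fun _ _ h => h.symm⟩
  loopless := ⟨fun v h => by rcases h with ⟨a, h⟩ | ⟨a, h⟩ <;> simp at h⟩

/-- The group of all graph automorphisms of the regular rooted tree. -/
abbrev TreeAut (d : ℕ) : Type := rootedTree d ≃g rootedTree d

namespace TreeAut

variable {d : ℕ}

theorem adj_append (v : List (Fin d)) (a : Fin d) : (rootedTree d).Adj v (v ++ [a]) :=
  Or.inl ⟨a, rfl⟩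

/-- Every automorphism fixes the root (the only vertex of degree `d`). -/
theorem map_root (g : TreeAut d) : g [] = [] := by
  by_contra hne
  obtain ⟨p, c, hp⟩ : ∃ p c, g [] = p ++ [c] := by
    rcases List.eq_nil_or_concat (g []) with h | ⟨p, c, h⟩
    · exact absurd h hne
    · exact ⟨p, c, by simpa using h⟩
  -- the `d + 1` neighbours of `g []` inject into the `d` children of the root
  let f : Option (Fin d) → List (Fin d) := fun o => o.elim p (fun a => g [] ++ [a])
  have hf : Function.Injective f := by
    intro o o' h
    rcases o with _ | a <;> rcases o' with _ | a' <;> simp_all [f]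
  have hadj : ∀ o, (rootedTree d).Adj (g []) (f o) := by
    intro o
    rcases o with _ | a
    · exact Or.inr ⟨c, hp⟩
    · exact adj_append _ a
  have hch : ∀ o, ∃ a : Fin d, g.symm (f o) = [a] := by
    intro o
    have h : (rootedTree d).Adj [] (g.symm (f o)) := by
      have := g.symm.map_rel_iff.mpr (hadj o)
      simpa using this
    rcases h with ⟨a, h⟩ | ⟨a, h⟩
    · exact ⟨a, by simpa using h⟩
    · simp at h
  choose e he using hch
  have hinj : Function.Injective e := by
    intro o o' h
    apply hf
    apply g.symm.injective
    rw [he, he, h]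
  have := Fintype.card_le_of_injective e hinj
  simp at this

/-- Every automorphism maps the children of a vertex to children of its image. -/
theorem map_append (g : TreeAut d) (v : List (Fin d)) :
    ∀ a, ∃ b, g (v ++ [a]) = g v ++ [b] := by
  induction v using List.reverseRecOn with
  | nil =>
    intro a
    rcases g.map_rel_iff.mpr (adj_append [] a) with h | ⟨b, h⟩
    · exact h
    · rw [map_root] at h
      simp at h
  | append_singleton u e ih =>
    intro a
    rcases g.map_rel_iff.mpr (adj_append (u ++ [e]) a) with h | ⟨b, h⟩
    · exact h
    · obtain ⟨c, hc⟩ := ih e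
      rw [hc] at h
      have h1 : g u = g (u ++ [e] ++ [a]) := (List.append_inj' h rfl).1
      have h2 := congrArg List.length (g.injective h1)
      simp at h2

/-- Every automorphism preserves the levels of the tree. -/
theorem length_map (g : TreeAut d) (v : List (Fin d)) : (g v).length = v.length := by
  induction v using List.reverseRecOn with
  | nil => rw [map_root]
  | append_singleton u e ih =>
    obtain ⟨b, hb⟩ := map_append g u e
    rw [hb]
    simp [ih]

end TreeAut

/-- The boundary of the `d`-regular rooted tree: an infinite path without backtracking from the
root is recorded as the infinite sequence of letters along it. -/
def Boundary (d : ℕ) : Type := ℕ → Fin d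

namespace Boundary

variable {d : ℕ}

/-- The σ-algebra generated by the cylinders. -/
instance instMeasurableSpace : MeasurableSpace (Boundary d) :=
  inferInstanceAs (MeasurableSpace (ℕ → Fin d))

/-- The vertex of level `k` on the path `x`: the word formed by the first `k` letters. -/
def vertex (x : Boundary d) (k : ℕ) : List (Fin d) := List.ofFn (fun i : Fin k => x i)

@[simp] theorem length_vertex (x : Boundary d) (k : ℕ) : (x.vertex k).length = k := by
  simp [vertex]

theorem vertex_succ (x : Boundary d) (k : ℕ) : x.vertex (k + 1) = x.vertex k ++ [x k] := by
  unfold vertex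
  rw [List.ofFn_succ_last]
  rfl

theorem ext_vertex {x y : Boundary d} (h : ∀ k, x.vertex k = y.vertex k) : x = y := by
  funext k
  have := h (k + 1)
  rw [vertex_succ, vertex_succ] at this
  simpa using (List.append_inj' this rfl).2

/-- The image of the path `x` under `g`; see `vertex_map`. -/
def map (g : TreeAut d) (x : Boundary d) : Boundary d :=
  fun k => (g (x.vertex (k + 1))).get ⟨k, by simp [TreeAut.length_map]⟩

/-- The image of `x` under `g` is the path through the images of the vertices of `x`. -/
theorem vertex_map (g : TreeAut d) (x : Boundary d) (k : ℕ) :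
    (map g x).vertex k = g (x.vertex k) := by
  induction k with
  | zero =>
    have h : ∀ y : Boundary d, y.vertex 0 = [] := fun y => by simp [vertex]
    rw [h, h, TreeAut.map_root]
  | succ k ih =>
    rw [vertex_succ, ih]
    obtain ⟨b, hb⟩ := TreeAut.map_append g (x.vertex k) (x k)
    rw [← vertex_succ] at hb
    have : map g x k = b := by
      simp [map, hb, TreeAut.length_map]
    rw [this, hb]

/-- The action of the automorphism group of the tree on the boundary. -/
instance instMulAction : MulAction (TreeAut d) (Boundary d) where
  smul := map
  one_smul x := ext_vertex fun k => vertex_map 1 x k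
  mul_smul g h x := ext_vertex fun k => by
    change (map (g * h) x).vertex k = (map g (map h x)).vertex k
    rw [vertex_map, vertex_map, vertex_map]
    rfl

/-- The uniform Bernoulli measure on the boundary: the infinite product of the uniform probability
measures on the alphabet. -/
def bernoulli (d : ℕ) : Measure (Boundary d) :=
  (Measure.infinitePi (fun _ : ℕ => uniformOn (Set.univ : Set (Fin d))) : Measure (ℕ → Fin d))

end Boundary

section BranchGroups

variable {d : ℕ}

/-- The rigid stabilizer in `G` of the vertex `v`: the elements of `G` which fix every vertex
outside the subtree of the words that begin with `v`. -/
def rist (G : Subgroup (TreeAut d)) (v : List (Fin d)) : Subgroup (TreeAut d) where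
  carrier := {g | g ∈ G ∧ ∀ w, ¬ v <+: w → g w = w}
  one_mem' := ⟨G.one_mem, fun _ _ => rfl⟩
  mul_mem' := by
    rintro g h ⟨hg, hg'⟩ ⟨hh, hh'⟩
    refine ⟨G.mul_mem hg hh, fun w hw => ?_⟩
    change g (h w) = w
    rw [hh' w hw, hg' w hw]
  inv_mem' := by
    rintro g ⟨hg, hg'⟩
    refine ⟨G.inv_mem hg, fun w hw => ?_⟩
    change g.symm w = w
    rw [RelIso.symm_apply_eq, hg' w hw]

/-- The rigid stabilizer of the `k`-th level: the subgroup generated by the rigid stabilizers of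
all vertices of level `k`. -/
def ristLevel (G : Subgroup (TreeAut d)) (k : ℕ) : Subgroup (TreeAut d) :=
  Subgroup.closure (⋃ v ∈ {v : List (Fin d) | v.length = k}, (rist G v : Set (TreeAut d)))

/-- A group of automorphisms of the tree is branch if it acts transitively on each level and the
rigid stabilizer of each level has finite index in it. -/
structure IsBranch (G : Subgroup (TreeAut d)) : Prop where
  transitive : ∀ v w : List (Fin d), v.length = w.length → ∃ g ∈ G, g v = w
  finiteIndex : ∀ k : ℕ, ((ristLevel G k).subgroupOf G).FiniteIndex

end BranchGroups

section SymmetricPower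

/-- Two `n`-tuples are equivalent if they differ by a permutation of the coordinates. -/
def permSetoid (X : Type*) (n : ℕ) : Setoid (Fin n → X) where
  r x y := ∃ σ : Equiv.Perm (Fin n), y = x ∘ σ
  iseqv :=
    { refl := fun _ => ⟨1, rfl⟩
      symm := by
        rintro x y ⟨σ, rfl⟩
        exact ⟨σ⁻¹, by ext i; simp⟩
      trans := by
        rintro x y z ⟨σ, rfl⟩ ⟨τ, rfl⟩
        exact ⟨σ * τ, rfl⟩ }

/-- The symmetric power `Xⁿ / Sym(n)`. -/
def SymPower (X : Type*) (n : ℕ) : Type _ := Quotient (permSetoid X n)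

namespace SymPower

/-- The quotient map `Xⁿ → Xⁿ / Sym(n)`. -/
def mk {X : Type*} {n : ℕ} (x : Fin n → X) : SymPower X n := Quotient.mk (permSetoid X n) x

/-- The quotient σ-algebra: a set is measurable when its preimage in `Xⁿ` is. -/
instance instMeasurableSpace {X : Type*} [MeasurableSpace X] {n : ℕ} :
    MeasurableSpace (SymPower X n) :=
  MeasurableSpace.map mk MeasurableSpace.pi

/-- The action on `Xⁿ / Sym(n)` induced by the diagonal action `g (x₁, …, xₙ) = (g x₁, …, g xₙ)`
on `Xⁿ`. -/
instance instMulAction {M X : Type*} [Monoid M] [MulAction M X] {n : ℕ} :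
    MulAction M (SymPower X n) where
  smul g := Quotient.map (fun x i => g • x i) (by
    rintro x y ⟨σ, rfl⟩
    exact ⟨σ, rfl⟩)
  one_smul q := by
    induction q using Quotient.inductionOn with
    | h x => exact congrArg mk (funext fun i => one_smul M (x i))
  mul_smul g h q := by
    induction q using Quotient.inductionOn with
    | h x => exact congrArg mk (funext fun i => mul_smul g h (x i))

/-- The image of the product measure `μⁿ` under the quotient map. -/
def measure {X : Type*} [MeasurableSpace X] (μ : Measure X) (n : ℕ) : Measure (SymPower X n) :=
  Measure.map mk (Measure.pi fun _ : Fin n => μ)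

end SymPower

end SymmetricPower

/-- A measurable invariant set `E` of positive measure is an ergodic component of an action if the
action is ergodic with respect to the normalized restriction of the measure to `E`. -/
structure IsErgodicComponent (G : Type*) {Y : Type*} [Group G] [MulAction G Y] [MeasurableSpace Y]
    (ν : Measure Y) (E : Set Y) : Prop where
  measurableSet : MeasurableSet E
  invariant : ∀ g : G, (fun y => g • y) ⁻¹' E = E
  pos : 0 < ν E
  ergodic : ErgodicSMul G Y (ν[|E])

end

/-! Cut the space by the level at which the paths of a tuple separate. On the box of tuples running
through prescribed distinct vertices `v₁, …, vₙ` of level `k`, an element of `rist G vᵢ` acting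
diagonally moves only the `i`-th path, so a `G`-invariant set is there invariant under each rigid
stabilizer acting on its own coordinate.

In one coordinate, a non-null subset of the cylinder of `v` invariant under `rist G v` is invariant
under all of `ristLevel G k`, because the other generators fix that cylinder pointwise. Since `G` is
ergodic on the boundary and this subgroup has finite index, the measure is at least the inverse of
the index (`IsBranch.inv_index_le_measure`). By Fubini, non-null invariant sets of tuples separated
at level `k` have measure at least the `n`-th power of that constant (`pow_le_measure_pi`,
`IsBranch.inv_index_pow_le_measure`).

Such a bound forces atoms in the algebra of invariant sets, and the separated sets exhaust the space
up to a null set, so ergodic components fill it (`exists_partition_isErgodicComponent`). For `n ≥ 2`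
no level separates almost all tuples, whereas finitely many components would all be separated, up to
null sets, at a common level (`infinite_of_isErgodicComponent`). -/

/-! ### Invariant sets and ergodic components -/

section InvariantSets

open Set Filter
open scoped ENNReal

/-- A measurable set which is invariant under an action. -/
structure IsInvariantSet (G : Type*) {Y : Type*} [SMul G Y] [MeasurableSpace Y] (E : Set Y) :
    Prop where
  measurableSet : MeasurableSet E
  preimage_eq : ∀ g : G, (fun y => g • y) ⁻¹' E = E

namespace IsInvariantSet

variable {G Y : Type*} [SMul G Y] [MeasurableSpace Y] {A B : Set Y}

protected theorem compl (hA : IsInvariantSet G A) : IsInvariantSet G Aᶜ :=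
  ⟨hA.1.compl, fun g => by rw [preimage_compl, hA.2 g]⟩

protected theorem inter (hA : IsInvariantSet G A) (hB : IsInvariantSet G B) :
    IsInvariantSet G (A ∩ B) :=
  ⟨hA.1.inter hB.1, fun g => by rw [preimage_inter, hA.2 g, hB.2 g]⟩

protected theorem union (hA : IsInvariantSet G A) (hB : IsInvariantSet G B) :
    IsInvariantSet G (A ∪ B) :=
  ⟨hA.1.union hB.1, fun g => by rw [preimage_union, hA.2 g, hB.2 g]⟩

protected theorem diff (hA : IsInvariantSet G A) (hB : IsInvariantSet G B) :
    IsInvariantSet G (A \ B) :=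
  hA.inter hB.compl

theorem sUnion {S : Set (Set Y)} (hS : S.Countable) (h : ∀ A ∈ S, IsInvariantSet G A) :
    IsInvariantSet G (⋃₀ S) :=
  ⟨.sUnion hS fun A hA => (h A hA).1, fun g => by
    rw [preimage_sUnion, sUnion_eq_biUnion]
    exact iUnion₂_congr fun A hA => (h A hA).2 g⟩

end IsInvariantSet

/-- An ergodic component is not split by an invariant set. -/
theorem IsErgodicComponent.measure_inter_eq_zero_or {G Y : Type*} [Group G]
    [MulAction G Y] [MeasurableSpace Y] {ν : Measure Y} [IsFiniteMeasure ν] {E A : Set Y}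
    (hE : IsErgodicComponent G ν E) (hA : IsInvariantSet G A) :
    ν (E ∩ A) = 0 ∨ ν (E \ A) = 0 := by
  have hne : (ν E)⁻¹ ≠ 0 := ENNReal.inv_ne_zero.2 (measure_ne_top ν E)
  have := hE.ergodic
  have hc := aeconst_of_forall_preimage_smul_ae_eq G (μ := ν[|E]) hA.1.nullMeasurableSet
    fun g => (hA.2 g).eventuallyEq
  rw [eventuallyConst_set', ae_eq_empty, ae_eq_univ, cond_apply hE.1, cond_apply hE.1] at hc
  rcases hc with h | h
  · exact Or.inl ((mul_eq_zero.1 h).resolve_left hne)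
  · exact Or.inr ((mul_eq_zero.1 h).resolve_left hne)

/-- A space exhausted by an increasing sequence of invariant sets, none of which is conull, has
infinitely many ergodic components. -/
theorem infinite_of_isErgodicComponent {G Y : Type*} [Group G] [MulAction G Y]
    [MeasurableSpace Y] {ν : Measure Y} [IsFiniteMeasure ν] {D : ℕ → Set Y} (hmono : Monotone D)
    (hDinv : ∀ k, IsInvariantSet G (D k)) (hDnull : ν (⋃ k, D k)ᶜ = 0)
    (hDpos : ∀ k, ν (D k)ᶜ ≠ 0) {𝓔 : Set (Set Y)} (h𝓔 : ∀ E ∈ 𝓔, IsErgodicComponent G ν E)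
    (huniv : ⋃₀ 𝓔 = univ) : 𝓔.Infinite := by
  intro hfin
  -- No `D k` splits `E`, so otherwise `E` would be almost disjoint from every `D k`, hence null.
  have hex : ∀ E ∈ 𝓔, ∃ k, ν (E \ D k) = 0 := by
    intro E hE
    by_contra! hcon
    refine (h𝓔 E hE).pos.ne' (measure_mono_null ?_ (measure_union_null
      (measure_iUnion_null fun k =>
        ((h𝓔 E hE).measure_inter_eq_zero_or (hDinv k)).resolve_right (hcon k)) hDnull))
    intro y hy
    by_cases h : y ∈ ⋃ k, D k
    · exact Or.inl (by rw [← inter_iUnion]; exact ⟨hy, h⟩)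
    · exact Or.inr h
  choose! k hk using hex
  obtain ⟨K, hK⟩ := (hfin.image k).bddAbove
  refine hDpos K (measure_mono_null (t := ⋃ E ∈ 𝓔, E \ D K) ?_
    ((measure_biUnion_null_iff hfin.countable).2 fun E hE =>
      measure_mono_null (sdiff_subset_sdiff_right (hmono (hK (mem_image_of_mem k hE)))) (hk E hE)))
  intro y hy
  obtain ⟨E, hE, hyE⟩ : y ∈ ⋃₀ 𝓔 := huniv ▸ mem_univ y
  exact mem_iUnion₂.2 ⟨E, hE, hyE, hy⟩

variable {G Y : Type*} [Group G] [Countable G] [MulAction G Y] [MeasurableSpace Y]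
  [MeasurableConstSMul G Y] {ν : Measure Y}

/-- For a countable group it is enough to test ergodicity on strictly invariant sets. -/
theorem ergodicSMul_of_isInvariantSet [SMulInvariantMeasure G Y ν]
    (h : ∀ A : Set Y, IsInvariantSet G A → ν A = 0 ∨ ν Aᶜ = 0) : ErgodicSMul G Y ν where
  aeconst_of_forall_preimage_smul_ae_eq := by
    intro s hs hinv
    -- The intersection of all translates is strictly invariant, and differs from `s` by a null set
    -- because `G` is countable.
    have hA : IsInvariantSet G (⋂ g : G, (fun y => g • y) ⁻¹' s) := by
      refine ⟨.iInter fun g => measurable_const_smul g hs, fun g => ?_⟩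
      ext y
      simp only [mem_preimage, mem_iInter, smul_smul]
      exact ⟨fun H k => by simpa using H (k * g⁻¹), fun H k => H (k * g)⟩
    have hae : (⋂ g : G, (fun y => g • y) ⁻¹' s) =ᵐ[ν] s := by
      have := Filter.EventuallyEq.countable_iInter (l := ae ν) hinv
      rwa [iInter_const] at this
    rw [← hae.eventuallyConst_iff, eventuallyConst_set']
    rcases h _ hA with h0 | h0
    · exact Or.inl (ae_eq_empty.2 h0)
    · exact Or.inr (ae_eq_univ.2 h0)

/-- Under an ergodic action, the measures of the sets invariant under a subgroup of finite index
are bounded away from zero. -/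
theorem one_le_index_mul_measure [ErgodicSMul G Y ν] (hν : ν univ = 1) (H : Subgroup G)
    [H.FiniteIndex] {B : Set Y} (hB : IsInvariantSet H B) (hpos : ν B ≠ 0) :
    1 ≤ H.index * ν B := by
  -- A translate of `B` depends only on the coset of `H`, so at most `H.index` translates, all of
  -- the same measure, cover the conull union below.
  have htrans : ∀ g : G, ∀ h : H, (fun y => (g * h)⁻¹ • y) ⁻¹' B = (fun y => g⁻¹ • y) ⁻¹' B := by
    intro g h
    conv_rhs => rw [← hB.2 h⁻¹]
    ext y
    simp only [mem_preimage, mul_inv_rev, mul_smul]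
    rfl
  have hU : IsInvariantSet G (⋃ g : G, (fun y => g⁻¹ • y) ⁻¹' B) := by
    refine ⟨.iUnion fun g => measurable_const_smul g⁻¹ hB.1, fun g => ?_⟩
    ext y
    simp only [mem_preimage, mem_iUnion, smul_smul]
    refine ⟨fun ⟨k, hk⟩ => ⟨g⁻¹ * k, by simpa using hk⟩, fun ⟨k, hk⟩ => ⟨g * k, by simpa using hk⟩⟩
  have hc := aeconst_of_forall_preimage_smul_ae_eq G (μ := ν) hU.1.nullMeasurableSet
    fun g => (hU.2 g).eventuallyEq
  rw [eventuallyConst_set', ae_eq_empty] at hc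
  have hfull : ν (⋃ g : G, (fun y => g⁻¹ • y) ⁻¹' B) = 1 := by
    rcases hc with h | h
    · refine absurd (measure_mono_null (fun y hy => mem_iUnion.2 ⟨1, ?_⟩) h) hpos
      simpa using hy
    · rw [measure_congr h, hν]
  have := H.fintypeQuotientOfFiniteIndex
  calc 1 = ν (⋃ g : G, (fun y => g⁻¹ • y) ⁻¹' B) := hfull.symm
    _ ≤ ν (⋃ q : G ⧸ H, (fun y => (Quotient.out q)⁻¹ • y) ⁻¹' B) := by
        refine measure_mono (iUnion_subset fun g => ?_)
        obtain ⟨h, hh⟩ := QuotientGroup.mk_out_eq_mul H g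
        rw [← htrans g h, ← hh]
        exact subset_iUnion (fun q : G ⧸ H => (fun y => (Quotient.out q)⁻¹ • y) ⁻¹' B) _
    _ ≤ ∑ q : G ⧸ H, ν ((fun y => (Quotient.out q)⁻¹ • y) ⁻¹' B) := measure_iUnion_fintype_le _ _
    _ = H.index * ν B := by
        simp_rw [measure_preimage_smul]
        rw [Finset.sum_const, nsmul_eq_mul, Finset.card_univ, H.index_eq_card,
          Nat.card_eq_fintype_card]

variable [SMulInvariantMeasure G Y ν]

/-- An invariant set of positive measure which cannot be split into two invariant sets of
positive measure is an ergodic component. -/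
theorem IsInvariantSet.isErgodicComponent {E : Set Y} (hE : IsInvariantSet G E) (hpos : 0 < ν E)
    (h : ∀ A : Set Y, IsInvariantSet G A → A ⊆ E → ν A = 0 ∨ ν (E \ A) = 0) :
    IsErgodicComponent G ν E where
  measurableSet := hE.1
  invariant := hE.2
  pos := hpos
  ergodic := by
    have : SMulInvariantMeasure G Y (ν[|E]) := ⟨fun g s hs => by
      rw [cond_apply hE.1, cond_apply hE.1]
      congr 1
      conv_lhs => rw [← hE.2 g]
      exact (measurePreserving_smul g ν).measure_preimage
        (hE.1.inter hs).nullMeasurableSet⟩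
    refine ergodicSMul_of_isInvariantSet fun A hA => ?_
    rw [cond_apply hE.1, cond_apply hE.1]
    rcases h (E ∩ A) (hE.inter hA) inter_subset_left with h0 | h0
    · exact Or.inl (by rw [h0, mul_zero])
    · refine Or.inr ?_
      rw [sdiff_self_inter] at h0
      rw [← sdiff_eq, h0, mul_zero]

variable [IsFiniteMeasure ν]

/-- If the measures of the invariant subsets of `D` of positive measure are bounded away from
zero, then each such subset contains an ergodic component. -/
theorem exists_isErgodicComponent_subset {D : Set Y} {c : ℝ≥0∞} (hc : c ≠ 0)
    (hD : ∀ A : Set Y, IsInvariantSet G A → A ⊆ D → ν A ≠ 0 → c ≤ ν A)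
    {B : Set Y} (hB : IsInvariantSet G B) (hBD : B ⊆ D) (hBpos : ν B ≠ 0) :
    ∃ E, E ⊆ B ∧ IsErgodicComponent G ν E := by
  set S : Set ℝ≥0∞ := {r | ∃ A : Set Y, IsInvariantSet G A ∧ A ⊆ B ∧ ν A ≠ 0 ∧ r = ν A} with hS
  have hBS : ν B ∈ S := ⟨B, hB, Subset.rfl, hBpos, rfl⟩
  -- The infimum need not be attained: measure below `sInf S + c` suffices, since two non-null
  -- invariant pieces would have measures at least `sInf S` and `c`.
  have hlt : sInf S < sInf S + c :=
    ENNReal.lt_add_right ((sInf_le hBS).trans_lt (measure_lt_top ν B)).ne hc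
  obtain ⟨r, ⟨E, hE, hEB, hEpos, rfl⟩, hr⟩ := sInf_lt_iff.1 hlt
  refine ⟨E, hEB, hE.isErgodicComponent (pos_iff_ne_zero.2 hEpos) fun A hA hAE => ?_⟩
  by_contra! hcon
  have h1 : sInf S ≤ ν A := sInf_le ⟨A, hA, hAE.trans hEB, hcon.1, rfl⟩
  have h2 : c ≤ ν (E \ A) :=
    hD _ (hE.diff hA) (sdiff_subset.trans (hEB.trans hBD)) hcon.2
  have h3 : ν A + ν (E \ A) = ν E := by
    rw [← measure_sdiff_add_inter E hA.1, inter_eq_right.2 hAE, add_comm]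
  exact absurd (h3 ▸ add_le_add h1 h2) (not_le.2 hr)

/-- A set of measure zero can be added to an ergodic component. -/
theorem IsErgodicComponent.union_null {E N : Set Y} (hE : IsErgodicComponent G ν E)
    (hN : IsInvariantSet G N) (h0 : ν N = 0) : IsErgodicComponent G ν (E ∪ N) := by
  have hE' : IsInvariantSet G E := ⟨hE.1, hE.2⟩
  refine (hE'.union hN).isErgodicComponent (hE.pos.trans_le (measure_mono subset_union_left))
    fun A hA _ => ?_
  rcases hE.measure_inter_eq_zero_or hA with h | h
  · refine Or.inl (measure_mono_null ?_ (measure_union_null h h0))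
    intro y hy
    by_cases hyN : y ∈ N
    · exact Or.inr hyN
    · exact Or.inl ⟨(‹A ⊆ E ∪ N› hy).resolve_right hyN, hy⟩
  · refine Or.inr (measure_mono_null ?_ (measure_union_null h h0))
    rintro y ⟨hy | hy, hyA⟩
    · exact Or.inl ⟨hy, hyA⟩
    · exact Or.inr hy

/-- If the space is exhausted by sets whose invariant subsets of positive measure have measure
bounded away from zero, then it splits into countably many ergodic components. -/
theorem exists_partition_isErgodicComponent (hν : ν ≠ 0) (D : ℕ → Set Y)
    (hDinv : ∀ k, IsInvariantSet G (D k)) (hDnull : ν (⋃ k, D k)ᶜ = 0) (c : ℕ → ℝ≥0∞)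
    (hc : ∀ k, c k ≠ 0)
    (hD : ∀ k, ∀ A : Set Y, IsInvariantSet G A → A ⊆ D k → ν A ≠ 0 → c k ≤ ν A) :
    ∃ 𝓔 : Set (Set Y), 𝓔.Countable ∧ (∀ E ∈ 𝓔, IsErgodicComponent G ν E) ∧
      𝓔.PairwiseDisjoint id ∧ ⋃₀ 𝓔 = univ := by
  have key : ∀ B : Set Y, IsInvariantSet G B → ν B ≠ 0 →
      ∃ E, E ⊆ B ∧ IsErgodicComponent G ν E := by
    intro B hB hpos
    obtain ⟨k, hk⟩ : ∃ k, ν (B ∩ D k) ≠ 0 := by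
      by_contra! hcon
      refine hpos (measure_mono_null ?_ (measure_union_null (measure_iUnion_null hcon) hDnull))
      intro y hy
      by_cases h : y ∈ ⋃ k, D k
      · exact Or.inl (by rw [← inter_iUnion]; exact ⟨hy, h⟩)
      · exact Or.inr h
    obtain ⟨E, hE, hE'⟩ := exists_isErgodicComponent_subset (hc k) (hD k)
      (hB.inter (hDinv k)) inter_subset_right hk
    exact ⟨E, hE.trans inter_subset_left, hE'⟩
  -- A maximal disjoint family of components: it is countable because its members have positive
  -- measure, and by `key` it leaves only a null set uncovered.
  obtain ⟨M, hM⟩ := zorn_subset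
    {S : Set (Set Y) | (∀ E ∈ S, IsErgodicComponent G ν E) ∧ S.PairwiseDisjoint id} (by
      intro C hC hchain
      refine ⟨⋃₀ C, ⟨?_, ?_⟩, fun s hs => subset_sUnion_of_mem hs⟩
      · rintro E ⟨S, hS, hES⟩
        exact (hC hS).1 E hES
      · exact (pairwiseDisjoint_sUnion hchain.directedOn).2 fun S hS => (hC hS).2)
  obtain ⟨⟨hMe, hMd⟩, hMmax⟩ := hM
  have hMc : M.Countable := by
    have := Measure.countable_meas_pos_of_disjoint_iUnion (μ := ν) (As := fun E : M => (E : Set Y))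
      (fun E => (hMe E E.2).1) (fun E F hEF => hMd E.2 F.2 (Subtype.coe_injective.ne hEF))
    have huniv : {E : M | 0 < ν (E : Set Y)} = univ := eq_univ_of_forall fun E => (hMe E E.2).pos
    rw [huniv, countable_univ_iff] at this
    exact this
  have hN : IsInvariantSet G (⋃₀ M)ᶜ :=
    (IsInvariantSet.sUnion hMc fun E hE => ⟨(hMe E hE).1, (hMe E hE).2⟩).compl
  have hN0 : ν (⋃₀ M)ᶜ = 0 := by
    by_contra hpos
    obtain ⟨E, hEN, hE⟩ := key _ hN hpos
    have hdisj : ∀ F ∈ M, Disjoint E F := fun F hF =>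
      (disjoint_compl_left.mono_right (subset_sUnion_of_mem hF)).mono_left hEN
    have hmem : E ∈ M := by
      refine hMmax (y := insert E M) ⟨?_, ?_⟩ (subset_insert E M) (mem_insert E M)
      · rintro F (rfl | hF)
        exacts [hE, hMe F hF]
      · exact hMd.insert fun F hF _ => hdisj F hF
    have := hE.pos
    rw [disjoint_self.1 (hdisj E hmem)] at this
    simp at this
  -- The null remainder cannot be a piece of its own, so it is absorbed into one component.
  obtain ⟨E₀, hE₀⟩ : M.Nonempty := by
    rw [nonempty_iff_ne_empty]
    rintro rfl
    rw [sUnion_empty, compl_empty] at hN0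
    exact hν (Measure.measure_univ_eq_zero.1 hN0)
  refine ⟨insert (E₀ ∪ (⋃₀ M)ᶜ) (M \ {E₀}), (hMc.mono sdiff_subset).insert _, ?_, ?_, ?_⟩
  · rintro E (rfl | hE)
    exacts [(hMe E₀ hE₀).union_null hN hN0, hMe E hE.1]
  · refine (hMd.subset sdiff_subset).insert fun F hF _ => disjoint_union_left.2 ⟨?_, ?_⟩
    · exact hMd hE₀ hF.1 fun h => hF.2 h.symm
    · exact disjoint_compl_left.mono_right (subset_sUnion_of_mem hF.1)
  · refine eq_univ_of_forall fun y => ?_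
    by_cases hy : y ∈ E₀ ∪ (⋃₀ M)ᶜ
    · exact ⟨_, mem_insert _ _, hy⟩
    · rw [mem_union, not_or, mem_compl_iff, not_not] at hy
      obtain ⟨F, hF, hyF⟩ := hy.2
      exact ⟨F, mem_insert_of_mem _ ⟨hF, fun h => hy.1 (h ▸ hyF)⟩, hyF⟩

end InvariantSets

/-! ### The action on the symmetric power -/

section SymmetricPower

open Set

namespace SymPower

variable {M X : Type*} [Monoid M] [MulAction M X] [MeasurableSpace X] {n : ℕ}

theorem measurable_mk : Measurable (mk : (Fin n → X) → SymPower X n) := fun _ h => h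

theorem measure_apply (μ : Measure X) {A : Set (SymPower X n)} (hA : MeasurableSet A) :
    measure μ n A = Measure.pi (fun _ : Fin n => μ) (mk ⁻¹' A) :=
  Measure.map_apply measurable_mk hA

instance instIsProbabilityMeasure (μ : Measure X) [IsProbabilityMeasure μ] :
    IsProbabilityMeasure (measure μ n) :=
  Measure.isProbabilityMeasure_map measurable_mk.aemeasurable

instance instMeasurableConstSMul [MeasurableConstSMul M X] :
    MeasurableConstSMul M (SymPower X n) where
  measurable_const_smul g A hA := by
    have h : Measurable fun (x : Fin n → X) i => g • x i :=
      measurable_pi_lambda _ fun i => (measurable_pi_apply i).const_smul g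
    exact h hA

instance instSMulInvariantMeasure [MeasurableConstSMul M X] (μ : Measure X) [SigmaFinite μ]
    [SMulInvariantMeasure M X μ] : SMulInvariantMeasure M (SymPower X n) (measure μ n) where
  measure_preimage_smul g A hA := by
    rw [measure_apply μ (measurable_const_smul g hA), measure_apply μ hA]
    exact (measurePreserving_pi (fun _ : Fin n => μ) (fun _ : Fin n => μ)
      fun _ => measurePreserving_smul g μ).measure_preimage
        (measurable_mk hA).nullMeasurableSet

end SymPower

end SymmetricPower

/-! ### Fubini estimates on powers -/

section ProductBound

open Set Function
open scoped ENNReal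

/-- If, for every `i`, the measures of the `H i`-invariant subsets of `S i` of positive measure are
at least `c`, then those of the subsets of `∏ i, S i` invariant under every `H i` acting on the
`i`-th coordinate are at least `c ^ n`. -/
theorem pow_le_measure_pi {M X : Type*} [SMul M X] [MeasurableSpace X] (μ : Measure X)
    [SigmaFinite μ] (c : ℝ≥0∞) (n : ℕ) (S : Fin n → Set X) (H : Fin n → Set M)
    (hS : ∀ i, ∀ B : Set X, MeasurableSet B → B ⊆ S i →
      (∀ g ∈ H i, ∀ x, g • x ∈ B ↔ x ∈ B) → μ B ≠ 0 → c ≤ μ B)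
    (A : Set (Fin n → X)) (hA : MeasurableSet A) (hAS : A ⊆ univ.pi S)
    (hinv : ∀ i, ∀ g ∈ H i, ∀ x, update x i (g • x i) ∈ A ↔ x ∈ A)
    (hpos : Measure.pi (fun _ => μ) A ≠ 0) : c ^ n ≤ Measure.pi (fun _ => μ) A := by
  induction n with
  | zero =>
    -- The empty product is a single point of mass `1 = c ^ 0`.
    have hne : A.Nonempty := nonempty_of_measure_ne_zero hpos
    rw [Subsingleton.eq_univ_of_nonempty hne]
    simp
  | succ n ih =>
    set P : Measure (Fin n → X) := Measure.pi fun _ => μ with hP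
    set s : X → Set (Fin n → X) := fun a => {y | (Fin.cons a y : Fin (n + 1) → X) ∈ A} with hs
    have hmp := (measurePreserving_piFinSuccAbove (fun _ : Fin (n + 1) => μ) 0).symm
    have hA' : MeasurableSet
        ((MeasurableEquiv.piFinSuccAbove (fun _ : Fin (n + 1) => X) 0).symm ⁻¹' A) :=
      MeasurableEquiv.measurable _ hA
    have hslice : ∀ a, Prod.mk a ⁻¹'
        ((MeasurableEquiv.piFinSuccAbove (fun _ : Fin (n + 1) => X) 0).symm ⁻¹' A) = s a := by
      intro a
      ext y
      simp [hs, MeasurableEquiv.piFinSuccAbove, Fin.insertNthEquiv]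
    have hmeas : Measurable fun a => P (s a) := by
      simpa only [hslice] using measurable_measure_prodMk_left (ν := P) hA'
    have hint : Measure.pi (fun _ : Fin (n + 1) => μ) A = ∫⁻ a, P (s a) ∂μ := by
      rw [← hmp.measure_preimage hA.nullMeasurableSet, Measure.prod_apply hA']
      simp only [hslice]
      rfl
    have hB : MeasurableSet {a | P (s a) ≠ 0} := hmeas (measurableSet_singleton 0).compl
    have hslices : ∀ a, P (s a) ≠ 0 → c ^ n ≤ P (s a) := by
      intro a ha
      refine ih (fun i => S i.succ) (fun i => H i.succ) (fun i => hS i.succ) (s a) ?_ ?_ ?_ ha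
      · rw [← hslice a]
        exact measurable_prodMk_left hA'
      · intro y hy i _
        simpa using hAS hy i.succ (mem_univ _)
      · intro i g hg y
        have := hinv i.succ g hg (Fin.cons a y)
        rw [Fin.cons_succ, ← Fin.cons_update] at this
        exact this
    -- Moving the first coordinate by `H 0` leaves the slice unchanged, so the one-coordinate bound
    -- applies to the set of non-null slices.
    have hBc : c ≤ μ {a | P (s a) ≠ 0} := by
      refine hS 0 _ hB ?_ ?_ ?_
      · intro a ha
        obtain ⟨y, hy⟩ := nonempty_of_measure_ne_zero ha
        simpa using hAS hy 0 (mem_univ _)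
      · intro g hg a
        have : s (g • a) = s a := by
          ext y
          have := hinv 0 g hg (Fin.cons a y)
          rwa [Fin.cons_zero, Fin.update_cons_zero] at this
        rw [mem_ofPred_eq, mem_ofPred_eq, this]
      · intro h0
        rw [hint] at hpos
        exact hpos ((lintegral_eq_zero_iff hmeas).2 h0)
    calc c ^ (n + 1) ≤ c ^ n * μ {a | P (s a) ≠ 0} := by rw [pow_succ]; gcongr
      _ = ∫⁻ _ in {a | P (s a) ≠ 0}, c ^ n ∂μ := by rw [setLIntegral_const]
      _ ≤ ∫⁻ a in {a | P (s a) ≠ 0}, P (s a) ∂μ := setLIntegral_mono hmeas hslices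
      _ ≤ ∫⁻ a, P (s a) ∂μ := setLIntegral_le_lintegral _ _
      _ = _ := hint.symm

/-- The diagonal hyperplanes of a power of an atomless measure are null. -/
theorem measure_pi_setOf_eq_eq_zero {X : Type*} [MeasurableSpace X] (μ : Measure X) [SigmaFinite μ]
    [NullSingletonClass μ] {n : ℕ} {i j : Fin n} (hij : i ≠ j)
    (hmeas : MeasurableSet {x : Fin n → X | x i = x j}) :
    Measure.pi (fun _ => μ) {x : Fin n → X | x i = x j} = 0 := by
  cases n with
  | zero => exact i.elim0
  | succ n =>
    obtain ⟨l, rfl⟩ := Fin.exists_succAbove_eq hij.symm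
    have hmp := (measurePreserving_piFinSuccAbove (fun _ : Fin (n + 1) => μ) i).symm
    rw [← hmp.measure_preimage hmeas.nullMeasurableSet,
      Measure.measure_prod_null (MeasurableEquiv.measurable _ hmeas)]
    refine Filter.Eventually.of_forall fun a => ?_
    refine measure_mono_null (fun y hy => ?_) (Measure.pi_hyperplane (fun _ : Fin n => μ) l a)
    simpa [MeasurableEquiv.piFinSuccAbove, Fin.insertNthEquiv, eq_comm] using hy

end ProductBound

/-! ### The Bernoulli measure and rigid stabilizers on the boundary -/

section BoundaryMeasure

open Set
open scoped ENNReal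

namespace Boundary

variable {d : ℕ}

/-- The set of paths through a vertex. -/
def cylinder (v : List (Fin d)) : Set (Boundary d) := {x | x.vertex v.length = v}

theorem mem_cylinder {x : Boundary d} {v : List (Fin d)} :
    x ∈ cylinder v ↔ x.vertex v.length = v := Iff.rfl

theorem mem_cylinder_of_length_eq {x : Boundary d} {v : List (Fin d)} {k : ℕ}
    (hv : v.length = k) : x ∈ cylinder v ↔ x.vertex k = v := by
  rw [mem_cylinder, hv]

theorem vertex_eq_vertex_iff {x y : Boundary d} {k : ℕ} :
    x.vertex k = y.vertex k ↔ ∀ i < k, x i = y i := by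
  unfold vertex
  rw [List.ofFn_inj, funext_iff]
  exact ⟨fun h i hi => h ⟨i, hi⟩, fun h i => h i i.2⟩

theorem vertex_prefix (x : Boundary d) {k l : ℕ} (h : k ≤ l) : x.vertex k <+: x.vertex l := by
  induction l, h using Nat.le_induction with
  | base => exact List.prefix_rfl
  | succ l _ ih =>
    rw [vertex_succ]
    exact ih.trans (List.prefix_append _ _)

theorem mem_cylinder_of_prefix {x : Boundary d} {v : List (Fin d)} {k : ℕ}
    (h : v <+: x.vertex k) : x ∈ cylinder v := by
  have hle : v.length ≤ k := by simpa using h.length_le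
  exact (List.prefix_of_prefix_length_le (x.vertex_prefix hle) h (by simp)).eq_of_length (by simp)

theorem smul_mem_cylinder_iff (g : TreeAut d) {x : Boundary d} {v : List (Fin d)} :
    g • x ∈ cylinder (g v) ↔ x ∈ cylinder v := by
  rw [mem_cylinder, mem_cylinder, TreeAut.length_map]
  change (map g x).vertex _ = _ ↔ _
  rw [vertex_map, EmbeddingLike.apply_eq_iff_eq]

theorem preimage_smul_cylinder (g : TreeAut d) (v : List (Fin d)) :
    (fun x : Boundary d => g • x) ⁻¹' cylinder v = cylinder (g⁻¹ v) := by
  ext x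
  have h : g (g⁻¹ v) = v := g.apply_symm_apply v
  rw [mem_preimage, ← smul_mem_cylinder_iff g (v := g⁻¹ v), h]

theorem measurable_prefix (k : ℕ) : Measurable fun (x : Boundary d) (i : Fin k) => x i :=
  measurable_pi_lambda _ fun i => measurable_pi_apply (X := fun _ : ℕ => Fin d) (i : ℕ)

theorem measurableSet_cylinder (v : List (Fin d)) : MeasurableSet (cylinder v) :=
  measurable_prefix v.length (MeasurableSet.of_discrete (s := {f | List.ofFn f = v}))

/-- Two cylinders that meet are nested. -/
theorem isPiSystem_cylinder : IsPiSystem (range (cylinder (d := d))) := by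
  have key : ∀ v w : List (Fin d), v.length ≤ w.length → (cylinder v ∩ cylinder w).Nonempty →
      cylinder v ∩ cylinder w = cylinder w := by
    rintro v w hle ⟨x, hxv, hxw⟩
    refine inter_eq_right.2 fun y hy => ?_
    have hxy : y.vertex w.length = x.vertex w.length := hy.trans hxw.symm
    rw [vertex_eq_vertex_iff] at hxy
    exact (vertex_eq_vertex_iff.2 fun i hi => hxy i (hi.trans_le hle)).trans hxv
  rintro _ ⟨v, rfl⟩ _ ⟨w, rfl⟩ hne
  rcases le_total v.length w.length with h | h
  · exact ⟨w, (key v w h hne).symm⟩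
  · rw [inter_comm] at hne ⊢
    exact ⟨v, (key w v h hne).symm⟩

/-- Automorphisms permute cylinders, so with this generator measurability and invariance of measure
need checking only on cylinders. -/
theorem generateFrom_cylinder :
    (instMeasurableSpace : MeasurableSpace (Boundary d)) =
      MeasurableSpace.generateFrom (range cylinder) := by
  refine le_antisymm (iSup_le fun i => ?_) (MeasurableSpace.generateFrom_le ?_)
  · refine Measurable.comap_le (m₁ := MeasurableSpace.generateFrom (range cylinder))
      (@measurable_to_countable' _ (Boundary d) _ _ (_) _ fun a => ?_)
    have : {x : Boundary d | x i = a} =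
        ⋃ v ∈ {v : List (Fin d) | v.length = i}, cylinder (v ++ [a]) := by
      ext x
      refine Iff.trans ⟨?_, ?_⟩ mem_iUnion₂.symm
      · rintro rfl
        refine ⟨x.vertex i, length_vertex x i, ?_⟩
        rw [mem_cylinder_of_length_eq (k := i + 1) (by simp)]
        exact vertex_succ x i
      · rintro ⟨v, hv, hx⟩
        rw [mem_ofPred_eq] at hv
        rw [mem_cylinder_of_length_eq (k := i + 1) (by simp [hv]), vertex_succ] at hx
        simpa using (List.append_inj' hx rfl).2
    change MeasurableSet[MeasurableSpace.generateFrom _] {x : Boundary d | x i = a}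
    rw [this]
    exact .biUnion (to_countable _) fun v _ =>
      MeasurableSpace.measurableSet_generateFrom (mem_range_self _)
  · rintro _ ⟨v, rfl⟩
    exact measurableSet_cylinder v

instance instMeasurableConstSMul : MeasurableConstSMul (TreeAut d) (Boundary d) where
  measurable_const_smul g := by
    rw [generateFrom_cylinder]
    refine @measurable_generateFrom _ _ (_) _ _ ?_
    rintro _ ⟨v, rfl⟩
    rw [preimage_smul_cylinder]
    exact MeasurableSpace.measurableSet_generateFrom (mem_range_self _)

instance instIsProbabilityMeasure [NeZero d] : IsProbabilityMeasure (bernoulli d) :=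
  inferInstanceAs (IsProbabilityMeasure (Measure.infinitePi
    (fun _ : ℕ => uniformOn (univ : Set (Fin d)))))

theorem bernoulli_cylinder [NeZero d] (v : List (Fin d)) :
    bernoulli d (cylinder v) = (d : ℝ≥0∞)⁻¹ ^ v.length := by
  -- The default letter `0` of `getD` is never read, as `i` stays below `v.length`.
  have hv : cylinder v = (Set.pi (Finset.range v.length)
      fun i => {v.getD i 0} : Set (ℕ → Fin d)) := by
    ext x
    refine List.ext_get_iff.trans ((and_iff_right (length_vertex x _)).trans ?_)
    refine forall_congr' fun i => ⟨fun h hi => ?_, fun h hi _ => ?_⟩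
    · have hi : i < v.length := by simpa using hi
      simpa [vertex, hi] using h (by simpa using hi) hi
    · have hi : i < v.length := by simpa using hi
      simpa [vertex, hi] using h (by simpa using hi)
  rw [hv]
  refine (Measure.infinitePi_pi (fun _ : ℕ => uniformOn (univ : Set (Fin d)))
    fun i _ => measurableSet_singleton _).trans ?_
  simp [uniformOn_univ]

instance instNullSingletonClass [Fact (2 ≤ d)] : NullSingletonClass (bernoulli d) where
  measure_singleton x := by
    have hd : 2 ≤ d := Fact.out
    have : NeZero d := ⟨by omega⟩
    have hlim := ENNReal.tendsto_pow_atTop_nhds_zero_of_lt_one (r := (d : ℝ≥0∞)⁻¹)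
      (ENNReal.inv_lt_one.2 (by exact_mod_cast hd))
    refine le_antisymm (ge_of_tendsto' hlim fun k => ?_) zero_le
    calc bernoulli d {x} ≤ bernoulli d (cylinder (x.vertex k)) :=
          measure_mono (singleton_subset_iff.2 (mem_cylinder_of_length_eq (by simp) |>.2 rfl))
      _ = _ := by rw [bernoulli_cylinder, length_vertex]

instance instSMulInvariantMeasure [NeZero d] :
    SMulInvariantMeasure (TreeAut d) (Boundary d) (bernoulli d) where
  measure_preimage_smul g s hs := by
    have hm : Measurable fun x : Boundary d => g • x := measurable_const_smul g
    rw [← Measure.map_apply hm hs]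
    have := Measure.isProbabilityMeasure_map (μ := bernoulli d) hm.aemeasurable
    congr 1
    refine ext_of_generate_finite _ generateFrom_cylinder isPiSystem_cylinder ?_ (by simp)
    rintro _ ⟨v, rfl⟩
    rw [Measure.map_apply hm (measurableSet_cylinder v), preimage_smul_cylinder, bernoulli_cylinder,
      bernoulli_cylinder, TreeAut.length_map]

/-- A set whose intersections with the cylinders of each level have the same measure is null or
conull. -/
theorem measure_eq_zero_or_one_of_forall_cylinder [NeZero d] {B : Set (Boundary d)}
    (hB : MeasurableSet B) (h : ∀ v w : List (Fin d), v.length = w.length →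
      bernoulli d (B ∩ cylinder v) = bernoulli d (B ∩ cylinder w)) :
    bernoulli d B = 0 ∨ bernoulli d B = 1 := by
  -- `B` is equidistributed over the `d ^ v.length` cylinders of a level, hence independent of each
  -- cylinder; the π-system argument then makes `B` independent of itself.
  have hcyl : ∀ v, bernoulli d (B ∩ cylinder v) = bernoulli d B * bernoulli d (cylinder v) := by
    intro v
    have hsum : bernoulli d B =
        ∑ f : Fin v.length → Fin d, bernoulli d (B ∩ cylinder (List.ofFn f)) := by
      rw [← measure_biUnion_finset]
      · congr 1
        ext x
        simp only [Finset.mem_univ, iUnion_true, mem_iUnion, mem_inter_iff]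
        refine ⟨fun hx => ⟨fun i => x i, hx, ?_⟩, fun ⟨_, hx, _⟩ => hx⟩
        rw [mem_cylinder_of_length_eq (k := v.length) (by simp)]
        rfl
      · intro f _ f' _ hff'
        refine disjoint_left.2 fun x hx hx' => hff' ?_
        have h1 := (mem_cylinder_of_length_eq (k := v.length) (by simp)).1 hx.2
        have h2 := (mem_cylinder_of_length_eq (k := v.length) (by simp)).1 hx'.2
        exact List.ofFn_injective (h1.symm.trans h2)
      · exact fun f _ => hB.inter (measurableSet_cylinder _)
    rw [Finset.sum_congr rfl fun f _ => h (List.ofFn f) v (by simp)] at hsum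
    rw [Finset.sum_const, Finset.card_univ, Fintype.card_fun, Fintype.card_fin, Fintype.card_fin,
      nsmul_eq_mul, Nat.cast_pow] at hsum
    have hd0 : (d : ℝ≥0∞) ^ v.length ≠ 0 := pow_ne_zero _ (by exact_mod_cast NeZero.ne d)
    have hdt : (d : ℝ≥0∞) ^ v.length ≠ ∞ := ENNReal.pow_ne_top (ENNReal.natCast_ne_top d)
    rw [bernoulli_cylinder, hsum, ← ENNReal.inv_pow, mul_right_comm,
      ENNReal.mul_inv_cancel hd0 hdt, one_mul]
  have hμ : (bernoulli d).restrict B = bernoulli d B • bernoulli d := by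
    refine ext_of_generate_finite _ generateFrom_cylinder isPiSystem_cylinder ?_ (by simp)
    rintro _ ⟨v, rfl⟩
    rw [Measure.restrict_apply (measurableSet_cylinder v), inter_comm, hcyl]
    rfl
  have hself : bernoulli d B = bernoulli d B * bernoulli d B := by
    conv_lhs => rw [← inter_self B, ← Measure.restrict_apply hB, hμ]
    rfl
  by_cases h0 : bernoulli d B = 0
  · exact Or.inl h0
  · refine Or.inr ?_
    have := (ENNReal.mul_right_inj h0 (measure_ne_top _ _)).1 (hself.symm.trans (mul_one _).symm)
    exact this

end Boundary

variable {d : ℕ} {G : Subgroup (TreeAut d)}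

open Boundary

/-- A countable group which is transitive on every level acts ergodically on the boundary. -/
theorem IsBranch.ergodicSMul [NeZero d] [Countable G] (hG : IsBranch G) :
    ErgodicSMul G (Boundary d) (bernoulli d) := by
  refine ergodicSMul_of_isInvariantSet fun B hB => ?_
  rw [prob_compl_eq_zero_iff hB.1]
  refine measure_eq_zero_or_one_of_forall_cylinder hB.1 fun v w hvw => ?_
  obtain ⟨g, hg, rfl⟩ := hG.transitive v w hvw
  rw [← measure_preimage_smul (bernoulli d) (⟨g, hg⟩ : G) (B ∩ cylinder (g v)), preimage_inter,
    hB.2]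
  congr 2
  ext x
  exact (smul_mem_cylinder_iff g).symm

/-- A path through `w` never enters the subtree below `v`, so all its vertices are fixed. -/
theorem smul_eq_of_mem_rist {v w : List (Fin d)} (hlen : v.length = w.length) (hne : v ≠ w)
    {g : TreeAut d} (hg : g ∈ rist G v) {x : Boundary d} (hx : x ∈ cylinder w) : g • x = x := by
  refine ext_vertex fun k => (vertex_map g x k).trans (hg.2 _ fun hpre => hne ?_)
  have := mem_cylinder_of_prefix hpre
  rw [Boundary.mem_cylinder, hlen] at this
  exact this.symm.trans hx

theorem map_eq_of_mem_rist {v : List (Fin d)} {g : TreeAut d} (hg : g ∈ rist G v) : g v = v := by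
  by_contra hne
  refine hne (g.injective (hg.2 (g v) fun hpre => hne ?_))
  exact (hpre.eq_of_length (TreeAut.length_map g v).symm).symm

theorem smul_mem_cylinder_of_mem_rist {v : List (Fin d)} {g : TreeAut d} (hg : g ∈ rist G v)
    {x : Boundary d} : g • x ∈ cylinder v ↔ x ∈ cylinder v := by
  conv_lhs => rw [← map_eq_of_mem_rist hg]
  exact smul_mem_cylinder_iff g

/-- The measures of the subsets of a cylinder of positive measure which are invariant under the
rigid stabilizer are bounded away from zero. -/
theorem IsBranch.inv_index_le_measure [NeZero d] [Countable G] (hG : IsBranch G)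
    {k : ℕ} {v : List (Fin d)} (hv : v.length = k) {B : Set (Boundary d)} (hB : MeasurableSet B)
    (hBv : B ⊆ cylinder v) (hinv : ∀ g ∈ rist G v, ∀ x, g • x ∈ B ↔ x ∈ B)
    (hpos : bernoulli d B ≠ 0) :
    (((ristLevel G k).subgroupOf G).index : ℝ≥0∞)⁻¹ ≤ bernoulli d B := by
  have := hG.ergodicSMul
  have := hG.finiteIndex k
  have hlevel : ∀ g ∈ ristLevel G k, ∀ x, g • x ∈ B ↔ x ∈ B := by
    intro g hg
    induction hg using Subgroup.closure_induction with
    | mem g hg =>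
      obtain ⟨w, hw, hgw⟩ := mem_iUnion₂.1 hg
      by_cases hwv : w = v
      · subst hwv
        exact hinv g hgw
      -- If `g • x ∈ B`, then `g` fixes `g • x`, and cancelling `g` gives `g • x = x`.
      · have hfix : ∀ y ∈ B, g • y = y := fun y hy =>
          smul_eq_of_mem_rist (hw.trans hv.symm) hwv hgw (hBv hy)
        intro x
        refine ⟨fun hx => ?_, fun hx => (hfix x hx).symm ▸ hx⟩
        rwa [← smul_left_cancel g (hfix _ hx)]
    | one => simp
    | mul g h _ _ ihg ihh => intro x; rw [mul_smul, ihg, ihh]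
    | inv g _ ih => intro x; rw [← ih, smul_inv_smul]
  have hinvB : IsInvariantSet ((ristLevel G k).subgroupOf G) B :=
    ⟨hB, fun h => Set.ext fun x => hlevel _ (Subgroup.mem_subgroupOf.1 h.2) x⟩
  have hle := one_le_index_mul_measure (measure_univ (μ := bernoulli d))
    ((ristLevel G k).subgroupOf G) hinvB hpos
  rw [← one_div]
  exact ENNReal.div_le_of_le_mul (by rwa [mul_comm])

end BoundaryMeasure

/-! ### Tuples separated at a level -/

section Separated

open Set
open scoped ENNReal
open Boundary

/-- The unordered tuples of paths which run through distinct vertices of level `k`. -/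
def separated (d n k : ℕ) : Set (SymPower (Boundary d) n) :=
  {q | ∃ x : Fin n → Boundary d, SymPower.mk x = q ∧
    Function.Injective fun i => (x i).vertex k}

variable {d n k : ℕ}

/-- Permuting coordinates preserves injectivity, so every representative may be tested. -/
theorem mk_mem_separated {x : Fin n → Boundary d} :
    SymPower.mk x ∈ separated d n k ↔ Function.Injective fun i => (x i).vertex k := by
  refine ⟨?_, fun h => ⟨x, rfl, h⟩⟩
  rintro ⟨y, hyx, hy⟩
  obtain ⟨σ, rfl⟩ := Quotient.exact hyx
  exact hy.comp σ.injective

theorem monotone_separated : Monotone (separated d n) := by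
  intro k l hkl q
  induction q using Quotient.inductionOn with
  | h x =>
    refine fun hq => mk_mem_separated.2 fun i j hij => mk_mem_separated.1 hq ?_
    have hij := vertex_eq_vertex_iff.1 hij
    exact vertex_eq_vertex_iff.2 fun m hm => hij m (hm.trans_le hkl)

theorem isInvariantSet_separated (G : Subgroup (TreeAut d)) :
    IsInvariantSet G (separated d n k) := by
  refine ⟨?_, fun g => ?_⟩
  · have hm : Measurable fun (x : Fin n → Boundary d) i (j : Fin k) => x i j :=
      measurable_pi_lambda _ fun i => (measurable_prefix k).comp (measurable_pi_apply i)
    have := hm (MeasurableSet.of_discrete (s := {F | Function.Injective fun i => List.ofFn (F i)}))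
    change MeasurableSet (SymPower.mk ⁻¹' separated d n k)
    convert this using 1
    ext x
    exact mk_mem_separated
  · ext q
    induction q using Quotient.inductionOn with
    | h x =>
      refine (mk_mem_separated (x := fun i => g • x i)).trans (Iff.trans ?_ mk_mem_separated.symm)
      have : (fun i => (g • x i).vertex k) = (g : TreeAut d) ∘ fun i => (x i).vertex k :=
        funext fun i => vertex_map g.1 (x i) k
      rw [this, (g : TreeAut d).injective.of_comp_iff]

/-- A tuple of distinct paths is separated at some level, so only the null diagonals remain. -/
theorem measure_compl_iUnion_separated (hd : 2 ≤ d) :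
    SymPower.measure (bernoulli d) n (⋃ k, separated d n k)ᶜ = 0 := by
  have : Fact (2 ≤ d) := ⟨hd⟩
  have : NeZero d := ⟨by omega⟩
  have hmeas : MeasurableSet (⋃ k, separated d n k) :=
    .iUnion fun k => (isInvariantSet_separated ⊤).1
  rw [SymPower.measure_apply _ hmeas.compl]
  have hnull : ∀ p ∈ {p : Fin n × Fin n | p.1 ≠ p.2},
      Measure.pi (fun _ : Fin n => bernoulli d) {x | x p.1 = x p.2} = 0 := by
    intro p hp
    refine measure_pi_setOf_eq_eq_zero _ hp ?_
    -- Equality of paths is tested letter by letter, each test factoring through the discrete space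
    -- `Fin 2 → Fin d`.
    have : {x : Fin n → Boundary d | x p.1 = x p.2} =
        ⋂ m : ℕ, (fun x (j : Fin 2) => if j = 0 then x p.1 m else x p.2 m) ⁻¹'
          {F : Fin 2 → Fin d | F 0 = F 1} := by
      ext x
      simp only [mem_iInter, mem_preimage, mem_ofPred_eq]
      exact ⟨fun h m => by simp [h], fun h => funext fun m => by simpa using h m⟩
    rw [this]
    refine .iInter fun m => (measurable_pi_lambda _ fun j => ?_) MeasurableSet.of_discrete
    have hev : ∀ i, Measurable fun x : Fin n → Boundary d => x i m := fun i =>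
      (measurable_pi_apply (X := fun _ : ℕ => Fin d) m).comp (measurable_pi_apply i)
    split_ifs
    exacts [hev _, hev _]
  refine measure_mono_null ?_ ((measure_biUnion_null_iff (to_countable _)).2 hnull)
  intro x hx
  by_contra hcon
  simp only [mem_iUnion, exists_prop, not_exists, not_and] at hcon
  have hsep : ∀ p : Fin n × Fin n, ∃ k, p.1 ≠ p.2 → (x p.1).vertex k ≠ (x p.2).vertex k := by
    intro p
    by_cases hp : p.1 = p.2
    · exact ⟨0, fun h => absurd hp h⟩
    · by_contra! hk
      exact hcon p hp (ext_vertex fun k => (hk k).2)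
  choose f hf using hsep
  -- The supremum over the finitely many pairs is a level separating all of them at once.
  refine hx (mem_iUnion.2 ⟨Finset.univ.sup f, mk_mem_separated.2 fun i j hij => ?_⟩)
  by_contra hne
  refine hf (i, j) hne (vertex_eq_vertex_iff.2 fun m hm => ?_)
  exact vertex_eq_vertex_iff.1 hij m (hm.trans_le (Finset.le_sup (Finset.mem_univ (i, j))))

theorem measure_compl_separated_ne_zero [NeZero d] (hn : 2 ≤ n) :
    SymPower.measure (bernoulli d) n (separated d n k)ᶜ ≠ 0 := by
  rw [SymPower.measure_apply _ (isInvariantSet_separated ⊤).1.compl]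
  -- Tuples whose paths all share one vertex of level `k` form a box of positive measure.
  have hle : univ.pi (fun _ : Fin n => cylinder (List.replicate k (0 : Fin d))) ⊆
      SymPower.mk ⁻¹' (separated d n k)ᶜ := by
    intro x hx hmem
    have hv : ∀ i, (x i).vertex k = List.replicate k 0 := fun i =>
      (mem_cylinder_of_length_eq (by simp)).1 (hx i (mem_univ i))
    have := mk_mem_separated.1 hmem (a₁ := ⟨0, by omega⟩) (a₂ := ⟨1, by omega⟩)
      ((hv _).trans (hv _).symm)
    simp at this
  refine fun h0 => absurd (measure_mono_null hle h0) ?_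
  rw [Measure.pi_pi]
  refine Finset.prod_ne_zero_iff.2 fun i _ => ?_
  rw [bernoulli_cylinder]
  exact pow_ne_zero _ (ENNReal.inv_ne_zero.2 (ENNReal.natCast_ne_top d))

/-- The measures of the invariant sets of positive measure of tuples separated at level `k` are
bounded away from zero. -/
theorem IsBranch.inv_index_pow_le_measure [NeZero d] {G : Subgroup (TreeAut d)} [Countable G]
    (hG : IsBranch G) {A : Set (SymPower (Boundary d) n)} (hA : IsInvariantSet G A)
    (hAk : A ⊆ separated d n k) (hpos : SymPower.measure (bernoulli d) n A ≠ 0) :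
    (((ristLevel G k).subgroupOf G).index : ℝ≥0∞)⁻¹ ^ n ≤ SymPower.measure (bernoulli d) n A := by
  rw [SymPower.measure_apply _ hA.1] at hpos ⊢
  have hA' : MeasurableSet (SymPower.mk ⁻¹' A) := SymPower.measurable_mk hA.1
  let v : (Fin n → Fin k → Fin d) → Fin n → List (Fin d) := fun f i => List.ofFn (f i)
  let S : (Fin n → Fin k → Fin d) → Set (Fin n → Boundary d) :=
    fun f => univ.pi fun i => cylinder (v f i)
  have hlen : ∀ f i, (v f i).length = k := fun f i => by simp [v]
  have hmem : ∀ f x, x ∈ S f ↔ ∀ i, (x i).vertex k = v f i := fun f x => by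
    simp only [S, mem_pi, mem_univ, true_imp_iff, mem_cylinder_of_length_eq (hlen f _)]
  -- Boxes over tuples of distinct level-`k` vertices cover the preimage of `A`, and there are
  -- countably many, so one of them meets it in positive measure.
  obtain ⟨f, hfinj, hf⟩ : ∃ f, Function.Injective (v f) ∧
      Measure.pi (fun _ => bernoulli d) (SymPower.mk ⁻¹' A ∩ S f) ≠ 0 := by
    by_contra! hcon
    refine hpos (measure_mono_null ?_ ((measure_biUnion_null_iff
      (to_countable {f | Function.Injective (v f)})).2 hcon))
    intro x hx
    exact mem_iUnion₂.2 ⟨fun i j => x i j, mk_mem_separated.1 (hAk hx), hx,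
      (hmem _ _).2 fun i => rfl⟩
  refine le_trans ?_ (measure_mono (inter_subset_left (t := S f)))
  refine pow_le_measure_pi (bernoulli d) _ n (fun i => cylinder (v f i))
    (fun i => (rist G (v f i) : Set (TreeAut d)))
    (fun i B hB hBS hinv hB0 => hG.inv_index_le_measure (hlen f i) hB hBS hinv hB0) _
    (hA'.inter (.univ_pi fun i => measurableSet_cylinder _)) inter_subset_right ?_ hf
  intro i g hg x
  have hS : Function.update x i (g • x i) ∈ S f ↔ x ∈ S f := by
    simp only [S, mem_univ_pi]
    refine forall_congr' fun j => ?_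
    by_cases hj : j = i
    · subst hj
      rw [Function.update_self, smul_mem_cylinder_of_mem_rist hg]
    · rw [Function.update_of_ne hj]
  rw [mem_inter_iff, mem_inter_iff, hS]
  refine and_congr_left fun hx => ?_
  -- The crux: the vertices are distinct, so `g` fixes every other path, and moving the `i`-th
  -- coordinate alone is the diagonal action, under which `A` is invariant.
  have hupd : Function.update x i (g • x i) = fun j => (⟨g, hg.1⟩ : G) • x j := by
    funext j
    by_cases hj : j = i
    · subst hj
      rw [Function.update_self]
      rfl
    · rw [Function.update_of_ne hj]
      exact (smul_eq_of_mem_rist ((hlen f i).trans (hlen f j).symm)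
        (hfinj.ne (Ne.symm hj)) hg (hx j (mem_univ j))).symm
  rw [hupd]
  exact Set.ext_iff.1 (hA.2 ⟨g, hg.1⟩) (SymPower.mk x)

end Separated

theorem mainTheorem3 (d : ℕ) (hd : 2 ≤ d) (G : Subgroup (TreeAut d)) [Countable G]
    (hG : IsBranch G) (n : ℕ) (hn : 1 ≤ n) :
    ∃ 𝓔 : Set (Set (SymPower (Boundary d) n)),
      𝓔.Countable ∧ (2 ≤ n → 𝓔.Infinite) ∧
      (∀ E ∈ 𝓔, IsErgodicComponent G (SymPower.measure (Boundary.bernoulli d) n) E) ∧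
      𝓔.PairwiseDisjoint id ∧ ⋃₀ 𝓔 = Set.univ := by
  have : NeZero d := ⟨by omega⟩
  have hnull := measure_compl_iUnion_separated (n := n) hd
  obtain ⟨𝓔, hcount, herg, hdisj, huniv⟩ := exists_partition_isErgodicComponent (G := G)
    (IsProbabilityMeasure.ne_zero (SymPower.measure (Boundary.bernoulli d) n))
    (separated d n) (fun k => isInvariantSet_separated G) hnull
    (fun k => (((ristLevel G k).subgroupOf G).index : ENNReal)⁻¹ ^ n)
    (fun k => pow_ne_zero _ (ENNReal.inv_ne_zero.2 (ENNReal.natCast_ne_top _)))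
    (fun k A hA hAk hpos => hG.inv_index_pow_le_measure hA hAk hpos)
  exact ⟨𝓔, hcount, fun h2 => infinite_of_isErgodicComponent monotone_separated
    (fun k => isInvariantSet_separated G) hnull (fun k => measure_compl_separated_ne_zero h2)
    herg huniv, herg, hdisj, huniv⟩
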